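/- Let $H$ be a separable complex Hilbert space with an orthonormal basis $\{e_i : i \in \Theta\}$, where $\Theta$ is a countable set with at least two elements, and let $(\omega_i)_{i\in\Theta}$ be positive real numbers with $\sum_{i} \omega_i = 1$. Let $\mathcal F(H) = \bigoplus_{n \ge 0} H^{\otimes n}$ be the full Fock space, let $l_i\eta = e_i \otimes \eta$ be the left creation operators, and define $P_\omega(x) = \sum_{i} \omega_i\, l_i^* x\, l_i$ for $x \in B(\mathcal F(H))$. Put $F(P_\omega) = \{x : P_\omega(x) = x\}$ (the Poisson boundary), $E_\lambda(P_\omega) = \{x : P_\omega(x) = \lambda x\}$, and let $P(P_\omega)$ (the peripheral Poisson boundary) be the norm closure of the linear span of $\bigcup_{|\lambda| = 1} E_\lambda(P_\omega)$. Then $P(P_\omega)$, with the norm, the unit and the involution of $B(\mathcal F(H))$ and with the modified Choi–Effros product $\circ$, i.e. the norm-continuous bilinear product with $$x \circ y = \mathrm{SOT}\text{-}\lim_{n\to\infty} (\lambda\mu)^{-n} P_\omega^n(xy) \qquad (x \in E_\lambda(P_\omega),\ y \in E_\mu(P_\omega),\ |\lambda| = |\mu| = 1),$$ is a unital C*-algebra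 that contains $F(P_\omega)$ as a unital C*-subalgebra, and there is a conditional expectation $E : P(P_\omega) \to F(P_\omega)$ with respect to this structure: a completely positive contractive idempotent map with range $F(P_\omega)$ that restricts to the identity on $F(P_\omega)$ and satisfies $E(a \circ x \circ b) = a \circ E(x) \circ b$ for $a, b \in F(P_\omega)$, $x \in P(P_\omega)$. -/

import Mathlib

open scoped TensorProduct CStarAlgebra ENNReal

universe u v

noncomputable section

/-! ### The full Fock space -/

/-- A complex Hilbert space together with its structure. It only serves to define the sequence
of tensor powers by recursion. -/
structure BundledHilbert where
  carrier : Type u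
  [normed : NormedAddCommGroup carrier]
  [inner : InnerProductSpace ℂ carrier]
  [complete : CompleteSpace carrier]

attribute [instance] BundledHilbert.normed BundledHilbert.inner BundledHilbert.complete

section FockSpace

variable (H : Type u) [NormedAddCommGroup H] [InnerProductSpace ℂ H]

/-- The Hilbert space tensor powers `H^{⊗ n}`: the one-dimensional space for `n = 0`, and the
completion of the algebraic tensor product `H ⊗ H^{⊗ n}` for `n + 1`. -/
def hilbertTensorPowerBundle : ℕ → BundledHilbert.{u}
  | 0 => ⟨EuclideanSpace ℂ PUnit.{u + 1}⟩
  | n + 1 => ⟨UniformSpace.Completion (H ⊗[ℂ] (hilbertTensorPowerBundle n).carrier)⟩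

/-- The Hilbert space `H^{⊗ n}`. -/
abbrev HilbertTensorPower (n : ℕ) : Type u := (hilbertTensorPowerBundle H n).carrier

/-- The full Fock space: the Hilbert space direct sum of all `H^{⊗ n}`, `n ≥ 0`. -/
abbrev FullFock : Type u := lp (fun n : ℕ => HilbertTensorPower H n) 2

variable {H}

/-- The map `η ↦ ξ ⊗ η` from `H^{⊗ n}` to `H^{⊗ (n + 1)}`. -/
def tensorLeft (ξ : H) (n : ℕ) : HilbertTensorPower H n →L[ℂ] HilbertTensorPower H (n + 1) :=
  (UniformSpace.Completion.toComplL (𝕜 := ℂ) (E := H ⊗[ℂ] HilbertTensorPower H n)).comp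
    (TensorProduct.mkL ℂ H (HilbertTensorPower H n) ξ)

theorem norm_tensorLeft (ξ : H) (n : ℕ) (η : HilbertTensorPower H n) :
    ‖tensorLeft ξ n η‖ = ‖ξ‖ * ‖η‖ :=
  (UniformSpace.Completion.norm_coe _).trans (TensorProduct.norm_tmul ξ η)

/-- The sequence `(0, ξ ⊗ f 0, ξ ⊗ f 1, …)`. -/
def creationFun (ξ : H) (f : ∀ n, HilbertTensorPower H n) : ∀ n, HilbertTensorPower H n
  | 0 => 0
  | n + 1 => tensorLeft ξ n (f n)

theorem creationFun_hasSum (ξ : H) (f : FullFock H) :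
    HasSum (fun n => ‖creationFun ξ f n‖ ^ (2 : ℝ)) ((‖ξ‖ * ‖f‖) ^ (2 : ℝ)) := by
  have h : HasSum (fun n => ‖f n‖ ^ (2 : ℝ)) (‖f‖ ^ (2 : ℝ)) := by
    simpa using lp.hasSum_norm (p := 2) (by norm_num) f
  have h2 : HasSum (fun n => ‖creationFun ξ f (n + 1)‖ ^ (2 : ℝ)) ((‖ξ‖ * ‖f‖) ^ (2 : ℝ)) := by
    have h3 := h.mul_left (‖ξ‖ ^ (2 : ℝ))
    rw [← Real.mul_rpow (norm_nonneg _) (norm_nonneg _)] at h3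
    refine h3.congr_fun ?_ |> id
    intro n
    show ‖tensorLeft ξ n (f n)‖ ^ (2 : ℝ) = _
    rw [norm_tensorLeft, Real.mul_rpow (norm_nonneg _) (norm_nonneg _)]
  have h4 := (hasSum_nat_add_iff' (f := fun n => ‖creationFun ξ f n‖ ^ (2 : ℝ))
    (g := (‖ξ‖ * ‖f‖) ^ (2 : ℝ)) 1).1
  apply h4
  simpa [creationFun] using h2

theorem creationFun_memℓp (ξ : H) (f : FullFock H) : Memℓp (creationFun ξ f) 2 :=
  memℓp_gen (by simpa using (creationFun_hasSum ξ f).summable)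

/-- The left creation operator `l_ξ η = ξ ⊗ η` on the full Fock space. -/
def leftCreation (ξ : H) : FullFock H →L[ℂ] FullFock H :=
  LinearMap.mkContinuous
    { toFun := fun f => ⟨creationFun ξ f, creationFun_memℓp ξ f⟩
      map_add' := fun f g => by
        ext n
        cases n with
        | zero => exact (add_zero (0 : HilbertTensorPower H 0)).symm
        | succ n => exact map_add (tensorLeft ξ n) (f n) (g n)
      map_smul' := fun c f => by
        ext n
        cases n with
        | zero => exact (smul_zero c).symm
        | succ n => exact map_smul (tensorLeft ξ n) c (f n) }
    ‖ξ‖ (fun f => by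
      refine le_of_eq ?_
      have h := lp.norm_rpow_eq_tsum (p := 2) (by norm_num)
        (⟨creationFun ξ f, creationFun_memℓp ξ f⟩ : FullFock H)
      have h2 := (creationFun_hasSum ξ f).tsum_eq
      rw [← Real.rpow_left_inj (norm_nonneg _) (by positivity) (two_ne_zero)]
      refine Eq.trans ?_ h2
      simpa using h)

/-- The map `P_ω (x) = ∑ i, ω i • (l_{e i})^* x l_{e i}` on the bounded operators of the full Fock
space. When the `e i` are unit vectors and `ω` is non-negative and summable, the series converges
absolutely in norm (`hasSum_fockMap`), hence also in the strong operator topology. -/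
def fockMap {Θ : Type v} (e : Θ → H) (ω : Θ → ℝ) (x : FullFock H →L[ℂ] FullFock H) :
    FullFock H →L[ℂ] FullFock H :=
  ∑' i, (ω i : ℂ) • (ContinuousLinearMap.adjoint (leftCreation (e i)) * x * leftCreation (e i))

theorem norm_leftCreation_le (ξ : H) : ‖leftCreation ξ‖ ≤ ‖ξ‖ :=
  LinearMap.mkContinuous_norm_le _ (norm_nonneg ξ) _

theorem hasSum_fockMap {Θ : Type v} (e : Θ → H) (he : ∀ i, ‖e i‖ = 1) (ω : Θ → ℝ)
    (hω : ∀ i, 0 ≤ ω i) (hs : Summable ω) (x : FullFock H →L[ℂ] FullFock H) :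
    HasSum (fun i => (ω i : ℂ) •
      (ContinuousLinearMap.adjoint (leftCreation (e i)) * x * leftCreation (e i)))
      (fockMap e ω x) := by
  refine Summable.hasSum (Summable.of_norm_bounded (hs.mul_right ‖x‖) fun i => ?_)
  have h1 : ‖leftCreation (e i)‖ ≤ 1 := (norm_leftCreation_le (e i)).trans_eq (he i)
  have h2 : ‖ContinuousLinearMap.adjoint (leftCreation (e i))‖ ≤ 1 := by
    rwa [LinearIsometryEquiv.norm_map]
  rw [norm_smul, Complex.norm_real, Real.norm_of_nonneg (hω i)]
  refine mul_le_mul_of_nonneg_left ?_ (hω i)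
  calc _ ≤ ‖ContinuousLinearMap.adjoint (leftCreation (e i)) * x‖ * ‖leftCreation (e i)‖ :=
        norm_mul_le _ _
    _ ≤ (‖ContinuousLinearMap.adjoint (leftCreation (e i))‖ * ‖x‖) * 1 := by
        gcongr
        exact norm_mul_le _ _
    _ ≤ (1 * ‖x‖) * 1 := by gcongr
    _ = ‖x‖ := by ring

end FockSpace

/-! ### Poisson boundary and peripheral Poisson boundary of a map on `B(K)` -/

section Boundary

variable {K : Type u} [NormedAddCommGroup K] [InnerProductSpace ℂ K] [CompleteSpace K]

/-- The eigenspace `E_μ(τ) = {x | τ x = μ x}`; for `μ = 1` this is the Poisson boundary. -/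
def eigenSet (τ : (K →L[ℂ] K) → (K →L[ℂ] K)) (μ : ℂ) : Set (K →L[ℂ] K) :=
  {x | τ x = μ • x}

/-- The Poisson boundary `F(τ)`, as a set: the fixed points of `τ`. -/
def poissonBoundary (τ : (K →L[ℂ] K) → (K →L[ℂ] K)) : Set (K →L[ℂ] K) :=
  {x | τ x = x}

/-- The peripheral Poisson boundary `P(τ)`, as an operator space: the norm closure of the span of
all eigenvectors for eigenvalues of modulus one. -/
def peripheralSpace (τ : (K →L[ℂ] K) → (K →L[ℂ] K)) : Submodule ℂ (K →L[ℂ] K) :=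
  (Submodule.span ℂ {x | ∃ μ : ℂ, ‖μ‖ = 1 ∧ x ∈ eigenSet τ μ}).topologicalClosure

/-- `ι : A → B(K)` identifies the C*-algebra `A` with the peripheral Poisson boundary `P(τ)`
carrying the norm, the linear structure, the unit and the involution of `B(K)` and the
(modified Choi–Effros) product, which for eigenvectors `x ∈ E_μ(τ)`, `y ∈ E_ν(τ)` is the strong
operator limit of `(μ ν)^{-n} τ^n (x y)`. As eigenvectors span a dense subspace, this
determines the product. -/
structure IsPeripheralPoissonBoundary (τ : (K →L[ℂ] K) → (K →L[ℂ] K))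
    {A : Type*} [CStarAlgebra A] (ι : A →ₗᵢ[ℂ] (K →L[ℂ] K)) : Prop where
  range_eq : Set.range ι = (peripheralSpace τ : Set (K →L[ℂ] K))
  map_one : ι 1 = 1
  map_star : ∀ a, ι (star a) = star (ι a)
  tendsto_mul : ∀ (μ ν : ℂ), ‖μ‖ = 1 → ‖ν‖ = 1 →
    ∀ a b : A, ι a ∈ eigenSet τ μ → ι b ∈ eigenSet τ ν → ∀ ξ : K,
      Filter.Tendsto (fun n : ℕ => ((μ * ν) ^ n)⁻¹ • (τ^[n] (ι a * ι b)) ξ) Filter.atTop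
        (nhds (ι (a * b) ξ))

end Boundary

/-- `E` is a conditional expectation of the C*-algebra `A` onto its unital *-subalgebra `S`: a
completely positive contractive idempotent with range `S` which is an `S`-bimodule map. -/
structure IsConditionalExpectationOnto {A : Type*} [CStarAlgebra A] [PartialOrder A]
    [StarOrderedRing A] (S : StarSubalgebra ℂ A) (E : A →CP A) : Prop where
  range_eq : Set.range E = (S : Set A)
  map_eq_self : ∀ s ∈ S, E s = s
  idempotent : ∀ a, E (E a) = E a
  norm_le : ∀ a, ‖E a‖ ≤ ‖a‖
  bimodule : ∀ s ∈ S, ∀ t ∈ S, ∀ a, E (s * a * t) = s * E a * t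

end

set_option linter.unusedSectionVars false

noncomputable section PeripheralBoundary

open Filter Topology

/-! Only two properties of `P_ω` matter: it is unital completely positive and normal. The result
holds for every such map τ on `B(K)`.

Let p be a free ultrafilter on the positive integers that is idempotent for addition, and let Q be
the weak operator limit of τ^n along p. Idempotence of p and normality of τ give Q² = Q. Moreover
c^n → 1 along p for every unimodular c, so Q fixes all peripheral eigenvectors at once, hence all of
P(τ). On operators fixed by Q, the Choi–Effros identities make Q(xy) an associative C*-product.

For x in E_μ and y in E_ν, a Cauchy–Schwarz inequality for the defect of multiplicativity shows that
(μν)^{-n} τ^n(xy) converges strongly. Evaluated along p, the limit is Q(xy), and it lies in E_{μν}.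
So P(τ) is closed under the product, and τ restricts to a *-endomorphism α of it with fixed-point
algebra F(τ).

The Cesàro means of α converge in norm: each eigenvector has limit itself or 0, and contractivity
extends convergence to the closed span. The limit is the conditional expectation; it inherits
complete positivity, contractivity and the bimodule property from the powers of α. -/

theorem sq_norm_le_mul_of_forall_nonneg {A C : ℝ} {B : ℂ}
    (h : ∀ t : ℂ, 0 ≤ A + 2 * (t * B).re + ‖t‖ ^ 2 * C) : ‖B‖ ^ 2 ≤ A * C := by
  have h1 : ∀ s : ℝ, 0 ≤ (‖B‖ ^ 2 * C) * (s * s) + (2 * ‖B‖ ^ 2) * s + A := by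
    intro s
    have h2 := h (s * (starRingEnd ℂ) B)
    have h3 : ((s : ℂ) * (starRingEnd ℂ) B * B).re = s * ‖B‖ ^ 2 := by
      rw [mul_assoc, mul_comm _ B, Complex.mul_conj, Complex.normSq_eq_norm_sq]
      norm_cast
    have h4 : ‖(s : ℂ) * (starRingEnd ℂ) B‖ ^ 2 = s ^ 2 * ‖B‖ ^ 2 := by
      rw [norm_mul, RCLike.norm_conj, mul_pow, Complex.norm_real, Real.norm_eq_abs, sq_abs]
    rw [h3, h4] at h2
    linarith
  -- Real t covers the case B = 0, where the discriminant of `h1` carries no information.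
  have h5 : ∀ s : ℝ, 0 ≤ C * (s * s) + (2 * B.re) * s + A := by
    intro s
    have h2 := h s
    have h3 : ((s : ℂ) * B).re = s * B.re := by simp
    rw [h3, Complex.norm_real, Real.norm_eq_abs, sq_abs] at h2
    linarith
  have h6 := discrim_le_zero h1
  have h7 := discrim_le_zero h5
  simp only [discrim] at h6 h7
  rcases (norm_nonneg B).eq_or_lt with h0 | h0
  · rw [← h0]
    nlinarith [sq_nonneg B.re]
  · have : 0 < ‖B‖ ^ 2 := by positivity
    nlinarith

/-! ### Unital completely positive maps and their defect of multiplicativity -/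

variable {K : Type u} [NormedAddCommGroup K] [InnerProductSpace ℂ K] [CompleteSpace K]

theorem inner_star_mul_apply (x y : K →L[ℂ] K) (ξ η : K) :
    inner ℂ ξ ((star x * y) η) = inner ℂ (x ξ) (y η) := by
  rw [ContinuousLinearMap.star_eq_adjoint, mul_apply_eq_comp,
    ContinuousLinearMap.adjoint_inner_right]

theorem inner_star_apply_left (x : K →L[ℂ] K) (ξ η : K) :
    inner ℂ (star x ξ) η = inner ℂ ξ (x η) := by
  rw [ContinuousLinearMap.star_eq_adjoint, ContinuousLinearMap.adjoint_inner_left]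

theorem inner_star_apply (x : K →L[ℂ] K) (ξ η : K) :
    inner ℂ ξ (star x η) = (starRingEnd ℂ) (inner ℂ η (x ξ)) := by
  rw [ContinuousLinearMap.star_eq_adjoint, ContinuousLinearMap.adjoint_inner_right,
    inner_conj_symm]

theorem re_inner_self (ξ : K) : (inner ℂ ξ ξ).re = ‖ξ‖ ^ 2 :=
  inner_self_eq_norm_sq (𝕜 := ℂ) ξ

theorem ContinuousLinearMap.eq_of_forall_inner {S T : K →L[ℂ] K}
    (h : ∀ ξ η, inner ℂ (S ξ) η = inner ℂ (T ξ) η) : S = T :=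
  ContinuousLinearMap.ext fun ξ => ext_inner_right ℂ (h ξ)

/-- A matrix of operators on `K` is positive as an operator on `K ⊕ ⋯ ⊕ K`. -/
def IsPosOperatorMatrix {k : ℕ} (a : Fin k → Fin k → (K →L[ℂ] K)) : Prop :=
  ∀ ξ : Fin k → K, 0 ≤ (∑ i, ∑ j, inner ℂ (ξ i) (a i j (ξ j))).re

/-- Unital completely positive maps on `B(K)`. -/
structure IsUnitalCP (τ : (K →L[ℂ] K) →ₗ[ℂ] (K →L[ℂ] K)) : Prop where
  map_one : τ 1 = 1
  map_star : ∀ x, τ (star x) = star (τ x)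
  map_posMatrix : ∀ {k : ℕ} (a : Fin k → Fin k → (K →L[ℂ] K)), IsPosOperatorMatrix a →
    IsPosOperatorMatrix fun i j => τ (a i j)

/-- The defect `τ (x* y) - τ(x)* τ(y)` of multiplicativity. -/
def multDefect (τ : (K →L[ℂ] K) →ₗ[ℂ] (K →L[ℂ] K)) (x y : K →L[ℂ] K) : K →L[ℂ] K :=
  τ (star x * y) - star (τ x) * τ y

theorem isPosOperatorMatrix_star_mul {k : ℕ} (x : Fin k → (K →L[ℂ] K)) :
    IsPosOperatorMatrix fun i j => star (x i) * x j := by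
  intro ξ
  have h : ∑ i, ∑ j, inner ℂ (ξ i) ((star (x i) * x j) (ξ j))
      = inner ℂ (∑ i, x i (ξ i)) (∑ j, x j (ξ j)) := by
    simp only [inner_star_mul_apply, sum_inner, inner_sum]
    exact Finset.sum_comm
  rw [h]
  exact inner_self_nonneg (𝕜 := ℂ)

namespace IsUnitalCP

variable {τ σ : (K →L[ℂ] K) →ₗ[ℂ] (K →L[ℂ] K)}

theorem id : IsUnitalCP (LinearMap.id : (K →L[ℂ] K) →ₗ[ℂ] (K →L[ℂ] K)) :=
  ⟨rfl, fun _ => rfl, fun _ h => h⟩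

theorem comp (hσ : IsUnitalCP σ) (hτ : IsUnitalCP τ) : IsUnitalCP (σ ∘ₗ τ) where
  map_one := by simp [hτ.map_one, hσ.map_one]
  map_star x := by simp [hτ.map_star, hσ.map_star]
  map_posMatrix a ha := hσ.map_posMatrix _ (hτ.map_posMatrix a ha)

theorem pow (hτ : IsUnitalCP τ) : ∀ n : ℕ, IsUnitalCP (τ ^ n)
  | 0 => id
  | n + 1 => by
    rw [pow_succ]
    exact (hτ.pow n).comp hτ

/-- A Schur complement: τ is applied to the Gram matrix of (1, x₁, …, x_k), and the first test
vector -∑ τ(x_i) ξ_i minimises the resulting quadratic form. -/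
theorem multDefect_pos (hτ : IsUnitalCP τ) {k : ℕ} (x : Fin k → (K →L[ℂ] K)) :
    IsPosOperatorMatrix fun i j => multDefect τ (x i) (x j) := by
  intro ξ
  have h := hτ.map_posMatrix _ (isPosOperatorMatrix_star_mul (Fin.cons 1 x))
    (Fin.cons (-∑ i, τ (x i) (ξ i)) ξ)
  simp only [Fin.sum_univ_succ, Fin.cons_zero, Fin.cons_succ, star_one, one_mul, mul_one,
    hτ.map_one, hτ.map_star] at h
  have h2 : ∀ i, inner ℂ (ξ i) ((star (τ (x i))) (-∑ j, τ (x j) (ξ j)))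
      = -∑ j, inner ℂ (ξ i) ((star (τ (x i)) * τ (x j)) (ξ j)) := by
    intro i
    rw [map_neg, inner_neg_right, map_sum, inner_sum]
    rfl
  simp only [h2, Finset.sum_add_distrib, one_apply_eq_self] at h
  have h3 : ∑ j, inner ℂ (-∑ i, τ (x i) (ξ i)) (τ (x j) (ξ j))
      = - inner ℂ (∑ i, τ (x i) (ξ i)) (∑ i, τ (x i) (ξ i)) := by
    rw [← inner_sum, inner_neg_left]
  rw [h3, inner_neg_neg] at h
  simp only [multDefect, sub_apply, inner_sub_right, Finset.sum_sub_distrib]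
  simp only [Finset.sum_neg_distrib] at h
  convert h using 2
  ring

theorem re_inner_apply_nonneg (hτ : IsUnitalCP τ) {a : K →L[ℂ] K}
    (ha : ∀ ξ, 0 ≤ (inner ℂ ξ (a ξ)).re) (ξ : K) : 0 ≤ (inner ℂ ξ (τ a ξ)).re := by
  have h := hτ.map_posMatrix (k := 1) (fun _ _ => a) (fun ξ => by simpa using ha (ξ 0))
    (fun _ => ξ)
  simpa using h

theorem re_inner_multDefect_nonneg (hτ : IsUnitalCP τ) (x : K →L[ℂ] K) (ξ : K) :
    0 ≤ (inner ℂ ξ (multDefect τ x x ξ)).re := by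
  simpa using hτ.multDefect_pos (k := 1) (fun _ => x) (fun _ => ξ)

/-- The Kadison-Schwarz inequality. -/
theorem sq_norm_apply_le (hτ : IsUnitalCP τ) (x : K →L[ℂ] K) (ξ : K) :
    ‖τ x ξ‖ ^ 2 ≤ (inner ℂ ξ (τ (star x * x) ξ)).re := by
  have h := hτ.re_inner_multDefect_nonneg x ξ
  rw [multDefect, sub_apply, inner_sub_right, inner_star_mul_apply,
    Complex.sub_re, re_inner_self] at h
  linarith

theorem norm_apply_le (hτ : IsUnitalCP τ) (x : K →L[ℂ] K) : ‖τ x‖ ≤ ‖x‖ := by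
  refine ContinuousLinearMap.opNorm_le_bound _ (norm_nonneg x) fun ξ => ?_
  have h1 := hτ.sq_norm_apply_le x ξ
  have h2 := hτ.re_inner_apply_nonneg (a := (((‖x‖ ^ 2 : ℝ) : ℂ) • (1 : K →L[ℂ] K)) - star x * x)
    (fun ξ => by
      rw [sub_apply, inner_sub_right, inner_star_mul_apply,
        smul_apply, one_apply_eq_self, inner_smul_right,
        Complex.sub_re, Complex.re_ofReal_mul, re_inner_self, re_inner_self, sub_nonneg, ← mul_pow]
      exact pow_le_pow_left₀ (norm_nonneg _) (x.le_opNorm ξ) 2) ξ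
  rw [map_sub, map_smul, hτ.map_one, sub_apply, inner_sub_right,
    smul_apply, one_apply_eq_self, inner_smul_right,
    Complex.sub_re, Complex.re_ofReal_mul, re_inner_self] at h2
  refine (pow_le_pow_iff_left₀ (norm_nonneg _) (by positivity) two_ne_zero).1 ?_
  rw [mul_pow]
  linarith

theorem star_multDefect (hτ : IsUnitalCP τ) (x y : K →L[ℂ] K) :
    star (multDefect τ x y) = multDefect τ y x := by
  simp [multDefect, ← hτ.map_star]

/-- The Cauchy-Schwarz inequality for the form `(x, y) ↦ ρ (σ(x* y) - σ(x)* σ(y))`. -/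
theorem sq_norm_inner_multDefect_le (hτ : IsUnitalCP τ) (hσ : IsUnitalCP σ) (x y : K →L[ℂ] K)
    (ξ η : K) :
    ‖inner ℂ η (τ (multDefect σ x y) ξ)‖ ^ 2 ≤
      (inner ℂ η (τ (multDefect σ x x) η)).re * (inner ℂ ξ (τ (multDefect σ y y) ξ)).re := by
  refine sq_norm_le_mul_of_forall_nonneg fun t => ?_
  have h := hτ.map_posMatrix _ (hσ.multDefect_pos ![x, y]) ![η, t • ξ]
  simp only [Fin.sum_univ_two, Matrix.cons_val_zero, Matrix.cons_val_one] at h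
  have h2 : inner ℂ (t • ξ) (τ (multDefect σ y x) η)
      = (starRingEnd ℂ) (inner ℂ η (τ (multDefect σ x y) (t • ξ))) := by
    rw [← hσ.star_multDefect, hτ.map_star, inner_star_apply]
  have h3 : inner ℂ (t • ξ) (τ (multDefect σ y y) (t • ξ))
      = ((‖t‖ ^ 2 : ℝ) : ℂ) * inner ℂ ξ (τ (multDefect σ y y) ξ) := by
    rw [map_smul, inner_smul_left, inner_smul_right, ← mul_assoc, mul_comm _ t, Complex.mul_conj,
      Complex.normSq_eq_norm_sq]
  rw [h2, h3, map_smul, inner_smul_right] at h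
  simp only [Complex.add_re, Complex.conj_re, Complex.re_ofReal_mul] at h
  linarith

theorem re_inner_apply_le (hτ : IsUnitalCP τ) (a : K →L[ℂ] K) (ξ : K) :
    (inner ℂ ξ (τ a ξ)).re ≤ ‖a‖ * ‖ξ‖ ^ 2 := by
  calc (inner ℂ ξ (τ a ξ)).re ≤ ‖inner ℂ ξ (τ a ξ)‖ := Complex.re_le_norm _
    _ ≤ ‖ξ‖ * ‖τ a ξ‖ := norm_inner_le_norm _ _
    _ ≤ ‖ξ‖ * (‖a‖ * ‖ξ‖) := by
      gcongr
      exact ((τ a).le_opNorm ξ).trans (by gcongr; exact hτ.norm_apply_le a)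
    _ = _ := by ring

/-- Cauchy–Schwarz with η equal to the vector being estimated, followed by division by ‖η‖². It
bounds norms by the diagonal defect of y alone, which yields strong and not merely weak convergence.
-/
theorem norm_multDefect_apply_sq_le (hτ : IsUnitalCP τ) (hσ : IsUnitalCP σ) (x y : K →L[ℂ] K)
    (ξ : K) : ‖τ (multDefect σ x y) ξ‖ ^ 2 ≤
      (2 * ‖x‖ ^ 2) * (inner ℂ ξ (τ (multDefect σ y y) ξ)).re := by
  set η := τ (multDefect σ x y) ξ with hη
  have h := hτ.sq_norm_inner_multDefect_le hσ x y ξ η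
  rw [← hη, inner_self_eq_norm_sq_to_K] at h
  have h0 : 0 ≤ (inner ℂ ξ (τ (multDefect σ y y) ξ)).re :=
    hτ.re_inner_apply_nonneg (hσ.re_inner_multDefect_nonneg y) ξ
  have h1 : ‖multDefect σ x x‖ ≤ 2 * ‖x‖ ^ 2 := by
    have h2 : ‖σ (star x * x)‖ ≤ ‖x‖ ^ 2 := (hσ.norm_apply_le _).trans
      ((norm_mul_le _ _).trans_eq (by rw [norm_star, sq]))
    have h3 : ‖star (σ x) * σ x‖ ≤ ‖x‖ ^ 2 := (norm_mul_le _ _).trans (by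
      rw [norm_star, ← sq]
      exact pow_le_pow_left₀ (norm_nonneg _) (hσ.norm_apply_le x) 2)
    exact (norm_sub_le _ _).trans (by linarith)
  have h4 := hτ.re_inner_apply_le (multDefect σ x x) η
  have h5 : ‖((‖η‖ : ℝ) : ℂ) ^ 2‖ ^ 2 = ‖η‖ ^ 2 * ‖η‖ ^ 2 := by
    rw [norm_pow, Complex.norm_real, norm_norm]; ring
  have h6 : ‖η‖ ^ 2 * ‖η‖ ^ 2 ≤
      ‖η‖ ^ 2 * ((2 * ‖x‖ ^ 2) * (inner ℂ ξ (τ (multDefect σ y y) ξ)).re) := by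
    rw [← h5]
    refine h.trans ?_
    calc _ ≤ ((2 * ‖x‖ ^ 2) * ‖η‖ ^ 2) * (inner ℂ ξ (τ (multDefect σ y y) ξ)).re := by
          gcongr
          exact h4.trans (by gcongr)
      _ = _ := by ring
  rcases (sq_nonneg ‖η‖).eq_or_lt with h7 | h7
  · rw [← h7]; positivity
  · exact le_of_mul_le_mul_left h6 h7

theorem pow_apply_of_mem_eigenSet {μ : ℂ} {x : K →L[ℂ] K} (hx : x ∈ eigenSet τ μ) (n : ℕ) :
    (τ ^ n) x = μ ^ n • x := by
  induction n with
  | zero => simp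
  | succ n ih =>
    have hx' : τ x = μ • x := hx
    rw [pow_succ, Module.End.mul_apply, hx', map_smul, ih, smul_smul, pow_succ, mul_comm]

theorem star_mem_eigenSet (hτ : IsUnitalCP τ) {μ : ℂ} {x : K →L[ℂ] K} (hx : x ∈ eigenSet τ μ) :
    star x ∈ eigenSet τ (star μ) := by
  have hx' : τ x = μ • x := hx
  change τ (star x) = _
  rw [hτ.map_star, hx', star_smul]

theorem multDefect_pow_of_mem_eigenSet {μ ν : ℂ} {x y : K →L[ℂ] K} (hx : x ∈ eigenSet τ μ)
    (hy : y ∈ eigenSet τ ν) (n : ℕ) :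
    multDefect (τ ^ n) x y = (τ ^ n) (star x * y) - (star μ * ν) ^ n • (star x * y) := by
  rw [multDefect, pow_apply_of_mem_eigenSet hx, pow_apply_of_mem_eigenSet hy, star_smul,
    smul_mul_smul_comm, mul_pow, star_pow]

/-- Positivity of the defect makes ⟨ξ, τ^n(y* y) ξ⟩ increasing, and it is bounded. Its increments
dominate the squared increments of the rescaled vectors, which are therefore Cauchy. -/
theorem exists_tendsto_pow_star_mul_apply (hτ : IsUnitalCP τ) {μ ν : ℂ} (hμ : ‖μ‖ = 1)
    (hν : ‖ν‖ = 1) {x y : K →L[ℂ] K} (hx : x ∈ eigenSet τ μ) (hy : y ∈ eigenSet τ ν) (ξ : K) :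
    ∃ ζ, Tendsto (fun n : ℕ => ((star μ * ν) ^ n)⁻¹ • ((τ ^ n) (star x * y)) ξ) atTop (𝓝 ζ) := by
  apply cauchySeq_tendsto_of_complete
  set c : ℂ := star μ * ν with hc
  have hc1 : ‖c‖ = 1 := by rw [hc, norm_mul, norm_star, hμ, hν, one_mul]
  have hc0 : c ≠ 0 := norm_ne_zero_iff.1 (by rw [hc1]; norm_num)
  set f : ℕ → ℝ := fun n => (inner ℂ ξ ((τ ^ n) (star y * y) ξ)).re with hf
  have hν2 : star ν * ν = 1 := by
    rw [← starRingEnd_apply, ← Complex.normSq_eq_conj_mul_self, Complex.normSq_eq_norm_sq, hν]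
    simp
  have hdiff : ∀ n m, (inner ℂ ξ ((τ ^ n) (multDefect (τ ^ m) y y) ξ)).re = f (n + m) - f n := by
    intro n m
    rw [multDefect_pow_of_mem_eigenSet hy hy, hν2, one_pow, one_smul, map_sub,
      ← Module.End.mul_apply, ← pow_add, sub_apply, inner_sub_right,
      Complex.sub_re]
  have hmono : Monotone f := by
    refine monotone_nat_of_le_succ fun n => ?_
    have := (hτ.pow n).re_inner_apply_nonneg ((hτ.pow 1).re_inner_multDefect_nonneg y) ξ
    rw [hdiff] at this
    linarith
  have hbdd : BddAbove (Set.range f) :=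
    ⟨‖star y * y‖ * ‖ξ‖ ^ 2, by rintro _ ⟨n, rfl⟩; exact (hτ.pow n).re_inner_apply_le _ ξ⟩
  have hcauchy : CauchySeq f := (tendsto_atTop_ciSup hmono hbdd).cauchySeq
  have key : ∀ n m, ‖((c ^ (n + m))⁻¹ • ((τ ^ (n + m)) (star x * y)) ξ)
      - ((c ^ n)⁻¹ • ((τ ^ n) (star x * y)) ξ)‖ ^ 2 ≤ (2 * ‖x‖ ^ 2) * (f (n + m) - f n) := by
    intro n m
    have h := (hτ.pow n).norm_multDefect_apply_sq_le (hτ.pow m) x y ξ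
    rw [hdiff] at h
    refine le_trans (le_of_eq ?_) h
    rw [multDefect_pow_of_mem_eigenSet hx hy, ← hc, map_sub, map_smul, ← Module.End.mul_apply,
      ← pow_add, sub_apply, smul_apply]
    have h2 : ((c ^ (n + m))⁻¹ • ((τ ^ (n + m)) (star x * y)) ξ)
      - ((c ^ n)⁻¹ • ((τ ^ n) (star x * y)) ξ) = (c ^ (n + m))⁻¹ •
        (((τ ^ (n + m)) (star x * y)) ξ - c ^ m • ((τ ^ n) (star x * y)) ξ) := by
      rw [smul_sub, smul_smul]
      congr 2
      field_simp
      exact pow_add c n m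
    rw [h2, norm_smul, norm_inv, norm_pow, hc1, one_pow, inv_one, one_mul]
  rw [Metric.cauchySeq_iff']
  intro ε hε
  -- The added 1 keeps the denominator positive when x = 0.
  obtain ⟨N, hN⟩ := Metric.cauchySeq_iff'.1 hcauchy (ε ^ 2 / (2 * ‖x‖ ^ 2 + 1)) (by positivity)
  refine ⟨N, fun n hn => ?_⟩
  obtain ⟨m, rfl⟩ := Nat.exists_eq_add_of_le hn
  have h1 := key N m
  have h2 := hN (N + m) hn
  rw [Real.dist_eq, lt_div_iff₀ (by positivity)] at h2
  rw [dist_eq_norm]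
  refine lt_of_pow_lt_pow_left₀ 2 hε.le (h1.trans_lt (lt_of_le_of_lt ?_ h2))
  have h3 := le_abs_self (f (N + m) - f N)
  have h4 := abs_nonneg (f (N + m) - f N)
  nlinarith [sq_nonneg ‖x‖]

/-- The strong operator limit defining the modified Choi-Effros product. -/
theorem exists_tendsto_pow_mul_apply (hτ : IsUnitalCP τ) {μ ν : ℂ} (hμ : ‖μ‖ = 1)
    (hν : ‖ν‖ = 1) {x y : K →L[ℂ] K} (hx : x ∈ eigenSet τ μ) (hy : y ∈ eigenSet τ ν) (ξ : K) :
    ∃ ζ, Tendsto (fun n : ℕ => ((μ * ν) ^ n)⁻¹ • ((τ ^ n) (x * y)) ξ) atTop (𝓝 ζ) := by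
  have h := hτ.exists_tendsto_pow_star_mul_apply (by rwa [norm_star]) hν
    (hτ.star_mem_eigenSet hx) hy ξ
  simpa only [star_star] using h

end IsUnitalCP

-- Free idempotent ultrafilters

attribute [local instance] Ultrafilter.addSemigroup Ultrafilter.add in
theorem exists_idempotent_ultrafilter_pnat : ∃ p : Ultrafilter ℕ+,
    (∀ P : ℕ+ → Prop, (∀ᶠ n in p, P n) → ∀ᶠ m in p, ∀ᶠ n in p, P (m + n)) ∧
    Tendsto (fun n : ℕ+ => (n : ℕ)) p atTop := by
  obtain ⟨p, hp⟩ := exists_idempotent_of_compact_t2_of_continuous_add_left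
    (Ultrafilter.continuous_add_left (M := ℕ+))
  have h : ∀ P : ℕ+ → Prop, (∀ᶠ n in p, P n) → ∀ᶠ m in p, ∀ᶠ n in p, P (m + n) := by
    intro P hP
    rw [← hp] at hP
    exact (Ultrafilter.eventually_add p p P).1 hP
  refine ⟨p, h, ?_⟩
  have h2 : (p : Filter ℕ+) ≤ cofinite := by
    rcases p.le_cofinite_or_eq_pure with h3 | ⟨k, hk⟩
    · exact h3
    -- A principal idempotent would give k + k = k, impossible for positive k; this is why the index
    -- set omits 0.
    · have h4 := h (fun n => n = k) (by rw [hk]; exact Filter.eventually_pure.2 rfl)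
      rw [hk] at h4
      have h5 : k + k = k := Filter.eventually_pure.1 (Filter.eventually_pure.1 h4)
      exact absurd (congrArg PNat.val h5) (by have := k.pos; simp)
  have h3 : Tendsto (fun n : ℕ+ => (n : ℕ)) cofinite cofinite :=
    PNat.coe_injective.tendsto_cofinite
  rw [Nat.cofinite_eq_atTop] at h3
  exact h3.mono_left h2

/-- Ultrafilters on the positive integers that are idempotent for addition and free. -/
structure IsFreeIdempotent (p : Ultrafilter ℕ+) : Prop where
  eventually_add : ∀ P : ℕ+ → Prop, (∀ᶠ n in p, P n) → ∀ᶠ m in p, ∀ᶠ n in p, P (m + n)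
  tendsto_coe : Tendsto (fun n : ℕ+ => (n : ℕ)) p atTop

theorem exists_tendsto_ultrafilter_of_norm_le {ι : Type*} (p : Ultrafilter ι) (f : ι → ℂ) (C : ℝ)
    (hf : ∀ n, ‖f n‖ ≤ C) : ∃ c, ‖c‖ ≤ C ∧ Tendsto f p (𝓝 c) := by
  obtain ⟨c, hc, h⟩ := (isCompact_closedBall (0 : ℂ) C).ultrafilter_le_nhds (p.map f)
    (le_principal_iff.2 (mem_map.2 (Filter.mem_of_superset univ_mem fun n _ => by
      simpa using hf n)))
  exact ⟨c, by simpa using hc, h⟩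

namespace IsFreeIdempotent

variable {p : Ultrafilter ℕ+}

/-- Idempotence of p says that the limit of f along p equals the iterated limit of f(m + n), first
in n and then in m. -/
theorem tendsto_iterated_eq (hp : IsFreeIdempotent p) {f g : ℕ+ → ℂ} {c d : ℂ}
    (hf : Tendsto f p (𝓝 c)) (hfg : ∀ m, Tendsto (fun n => f (m + n)) p (𝓝 (g m)))
    (hg : Tendsto g p (𝓝 d)) : d = c := by
  refine dist_le_zero.1 (le_of_forall_pos_le_add fun ε hε => ?_)
  rw [zero_add]
  have h1 := hp.eventually_add _ (hf.eventually (Metric.closedBall_mem_nhds c hε))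
  have h2 : ∀ᶠ m in p, g m ∈ Metric.closedBall c ε := by
    filter_upwards [h1] with m hm
    exact Metric.isClosed_closedBall.mem_of_tendsto (hfg m) hm
  exact Metric.isClosed_closedBall.mem_of_tendsto hg h2

/-- The limit d exists by compactness. Idempotence gives d² = d, and |d| = 1 then leaves only d = 1.
-/
theorem tendsto_pow (hp : IsFreeIdempotent p) {c : ℂ} (hc : ‖c‖ = 1) :
    Tendsto (fun n : ℕ+ => c ^ (n : ℕ)) p (𝓝 1) := by
  obtain ⟨d, -, hd⟩ := exists_tendsto_ultrafilter_of_norm_le p (fun n : ℕ+ => c ^ (n : ℕ)) 1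
    (fun n => by rw [norm_pow, hc, one_pow])
  have h1 : d * d = d := hp.tendsto_iterated_eq hd (g := fun m => c ^ (m : ℕ) * d)
    (fun m => by simpa [pow_add] using hd.const_mul (c ^ (m : ℕ))) (hd.mul_const d)
  have h2 : ‖d‖ = 1 := tendsto_nhds_unique hd.norm (by simp [hc])
  have h3 : d ≠ 0 := norm_ne_zero_iff.1 (by rw [h2]; norm_num)
  rwa [mul_eq_left₀ h3 |>.1 h1] at hd

end IsFreeIdempotent

/-! ### Weak operator limits and the projection Q -/

/-- Convergence in the weak operator topology. -/
def TendstoWOT {ι : Type*} (a : ι → (K →L[ℂ] K)) (l : Filter ι) (T : K →L[ℂ] K) : Prop :=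
  ∀ ξ η, Tendsto (fun n => inner ℂ (a n ξ) η) l (𝓝 (inner ℂ (T ξ) η))

theorem TendstoWOT.unique {ι : Type*} {a : ι → (K →L[ℂ] K)} {l : Filter ι} [l.NeBot]
    {S T : K →L[ℂ] K} (hS : TendstoWOT a l S) (hT : TendstoWOT a l T) : S = T :=
  ContinuousLinearMap.eq_of_forall_inner fun ξ η => tendsto_nhds_unique (hS ξ η) (hT ξ η)

theorem TendstoWOT.tendsto_inner {ι : Type*} {a : ι → (K →L[ℂ] K)} {l : Filter ι}
    {T : K →L[ℂ] K} (h : TendstoWOT a l T) (ξ η : K) :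
    Tendsto (fun n => inner ℂ ξ (a n η)) l (𝓝 (inner ℂ ξ (T η))) := by
  have := (Complex.continuous_conj.tendsto _).comp (h η ξ)
  simpa only [Function.comp_def, inner_conj_symm] using this

/-- The matrix coefficients converge by compactness to a bounded sesquilinear form, which the Riesz
theorem represents by an operator. -/
theorem exists_tendstoWOT_ultrafilter {ι : Type*} (p : Ultrafilter ι) (a : ι → (K →L[ℂ] K))
    (C : ℝ) (ha : ∀ n, ‖a n‖ ≤ C) : ∃ T, TendstoWOT a p T := by
  have hb : ∀ ξ η n, ‖inner ℂ (a n ξ) η‖ ≤ C * ‖ξ‖ * ‖η‖ := fun ξ η n =>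
    (norm_inner_le_norm _ _).trans (by
      gcongr
      exact (a n).le_of_opNorm_le (ha n) ξ)
  choose B hB hB2 using fun ξ η => exists_tendsto_ultrafilter_of_norm_le p
    (fun n => inner ℂ (a n ξ) η) _ (hb ξ η)
  let B' : K →L⋆[ℂ] K →L[ℂ] ℂ := LinearMap.mkContinuous₂
    (LinearMap.mk₂'ₛₗ (starRingEnd ℂ) (RingHom.id ℂ) B
      (fun x y z => tendsto_nhds_unique (hB2 (x + y) z) (by
        simpa only [map_add, inner_add_left] using (hB2 x z).add (hB2 y z)))
      (fun c x z => tendsto_nhds_unique (hB2 (c • x) z) (by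
        simpa only [map_smul, inner_smul_left, smul_eq_mul] using
          (hB2 x z).const_mul (starRingEnd ℂ c)))
      (fun x y z => tendsto_nhds_unique (hB2 x (y + z)) (by
        simpa only [inner_add_right] using (hB2 x y).add (hB2 x z)))
      (fun c x z => tendsto_nhds_unique (hB2 x (c • z)) (by
        simpa only [inner_smul_right, smul_eq_mul, RingHom.id_apply] using
          (hB2 x z).const_mul c)))
    C hB
  refine ⟨InnerProductSpace.continuousLinearMapOfBilin B', fun ξ η => ?_⟩
  rw [InnerProductSpace.continuousLinearMapOfBilin_apply]
  exact hB2 ξ η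

/-- Continuity on bounded sets for the weak operator topology. -/
def IsNormalMap (τ : (K →L[ℂ] K) →ₗ[ℂ] (K →L[ℂ] K)) : Prop :=
  ∀ (l : Filter ℕ+) (a : ℕ+ → (K →L[ℂ] K)) (b : K →L[ℂ] K) (C : ℝ), (∀ n, ‖a n‖ ≤ C) →
    TendstoWOT a l b → TendstoWOT (fun n => τ (a n)) l (τ b)

theorem IsNormalMap.pow {τ : (K →L[ℂ] K) →ₗ[ℂ] (K →L[ℂ] K)} (hτ : IsUnitalCP τ)
    (hn : IsNormalMap τ) : ∀ n : ℕ, IsNormalMap (τ ^ n)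
  | 0 => fun _ _ _ _ _ h => h
  | n + 1 => fun l a b C hC h => by
    rw [pow_succ]
    exact hn.pow hτ n l _ _ C (fun k => (hτ.norm_apply_le _).trans (hC k)) (hn l a b C hC h)

/-- The limit of the powers of `τ` along a free idempotent ultrafilter is a unital completely
positive projection. -/
theorem IsUnitalCP.exists_projection {τ : (K →L[ℂ] K) →ₗ[ℂ] (K →L[ℂ] K)} (hτ : IsUnitalCP τ)
    (hn : IsNormalMap τ) {p : Ultrafilter ℕ+} (hp : IsFreeIdempotent p) :
    ∃ Q : (K →L[ℂ] K) →ₗ[ℂ] (K →L[ℂ] K), IsUnitalCP Q ∧ (∀ x, Q (Q x) = Q x) ∧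
      ∀ x, TendstoWOT (fun n : ℕ+ => (τ ^ (n : ℕ)) x) p (Q x) := by
  choose Q hQ using fun x => exists_tendstoWOT_ultrafilter p (fun n : ℕ+ => (τ ^ (n : ℕ)) x) ‖x‖
    (fun n => (hτ.pow n).norm_apply_le x)
  let Q' : (K →L[ℂ] K) →ₗ[ℂ] (K →L[ℂ] K) :=
    { toFun := Q
      map_add' := fun x y => (hQ (x + y)).unique fun ξ η => by
        simpa only [map_add, add_apply, inner_add_left] using (hQ x ξ η).add (hQ y ξ η)
      map_smul' := fun c x => (hQ (c • x)).unique fun ξ η => by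
        simpa only [map_smul, smul_apply, inner_smul_left, RingHom.id_apply] using
          (hQ x ξ η).const_mul (starRingEnd ℂ c) }
  refine ⟨Q', ⟨?_, ?_, ?_⟩, ?_, hQ⟩
  · exact (hQ 1).unique fun ξ η => by simp only [(hτ.pow _).map_one]; exact tendsto_const_nhds
  · refine fun x => (hQ (star x)).unique fun ξ η => ?_
    have h := (hQ x).tendsto_inner ξ η
    change Tendsto _ _ (𝓝 (inner ℂ (star (Q x) ξ) η))
    simpa only [(hτ.pow _).map_star, inner_star_apply_left] using h
  · intro k a ha ξ
    refine ge_of_tendsto' ((Complex.continuous_re.tendsto _).comp (tendsto_finsetSum _ fun i _ =>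
      tendsto_finsetSum _ fun j _ => (hQ (a i j)).tendsto_inner (ξ i) (ξ j))) fun n => ?_
    exact (hτ.pow n).map_posMatrix a ha ξ
  -- Normality of τ^m turns lim_n τ^{m+n}(x) into τ^m(Q x), so Q(Q x) is the iterated limit.
  · refine fun x => ContinuousLinearMap.eq_of_forall_inner fun ξ η => ?_
    refine hp.tendsto_iterated_eq (hQ x ξ η) (fun m => ?_) (hQ (Q x) ξ η)
    have h := (hn.pow hτ m) p _ _ ‖x‖ (fun n => (hτ.pow (n : ℕ)).norm_apply_le x) (hQ x) ξ η
    simpa only [PNat.add_coe, pow_add, Module.End.mul_apply] using h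

section Projection

variable {τ Q : (K →L[ℂ] K) →ₗ[ℂ] (K →L[ℂ] K)} {p : Ultrafilter ℕ+}

theorem projection_apply_of_mem_eigenSet (hp : IsFreeIdempotent p)
    (hQ : ∀ x, TendstoWOT (fun n : ℕ+ => (τ ^ (n : ℕ)) x) p (Q x)) {μ : ℂ} (hμ : ‖μ‖ = 1)
    {x : K →L[ℂ] K} (hx : x ∈ eigenSet τ μ) : Q x = x := by
  refine (hQ x).unique fun ξ η => ?_
  have h := (hp.tendsto_pow (c := starRingEnd ℂ μ) (by rwa [RCLike.norm_conj])).mul_const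
    (inner ℂ (x ξ) η)
  rw [one_mul] at h
  simpa only [IsUnitalCP.pow_apply_of_mem_eigenSet hx, smul_apply, inner_smul_left,
    map_pow] using h

/-- The strong limit already exists, so it can be computed along p, where the factors (μν)^{-n} tend
to 1. In particular Q(xy) does not depend on p. -/
theorem tendsto_pow_mul_apply_projection (hτ : IsUnitalCP τ) (hp : IsFreeIdempotent p)
    (hQ : ∀ x, TendstoWOT (fun n : ℕ+ => (τ ^ (n : ℕ)) x) p (Q x)) {μ ν : ℂ} (hμ : ‖μ‖ = 1)
    (hν : ‖ν‖ = 1) {x y : K →L[ℂ] K} (hx : x ∈ eigenSet τ μ) (hy : y ∈ eigenSet τ ν) (ξ : K) :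
    Tendsto (fun n : ℕ => ((μ * ν) ^ n)⁻¹ • ((τ ^ n) (x * y)) ξ) atTop
      (𝓝 (Q (x * y) ξ)) := by
  obtain ⟨ζ, hζ⟩ := hτ.exists_tendsto_pow_mul_apply hμ hν hx hy ξ
  suffices Q (x * y) ξ = ζ by rwa [this]
  have hc : ‖(starRingEnd ℂ) (μ * ν)⁻¹‖ = 1 := by simp [hμ, hν]
  refine ext_inner_right ℂ fun η => tendsto_nhds_unique (f := fun n : ℕ+ =>
    inner ℂ (((μ * ν) ^ (n : ℕ))⁻¹ • ((τ ^ (n : ℕ)) (x * y)) ξ) η) (l := (p : Filter ℕ+)) ?_ ?_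
  · have h := (hp.tendsto_pow hc).mul (hQ (x * y) ξ η)
    rw [one_mul] at h
    simpa only [inner_smul_left, ← inv_pow, map_pow] using h
  · exact (hζ.comp hp.tendsto_coe).inner tendsto_const_nhds

theorem projection_mul_mem_eigenSet (hτ : IsUnitalCP τ) (hn : IsNormalMap τ)
    (hp : IsFreeIdempotent p)
    (hQ : ∀ x, TendstoWOT (fun n : ℕ+ => (τ ^ (n : ℕ)) x) p (Q x)) {μ ν : ℂ} (hμ : ‖μ‖ = 1)
    (hν : ‖ν‖ = 1) {x y : K →L[ℂ] K} (hx : x ∈ eigenSet τ μ) (hy : y ∈ eigenSet τ ν) :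
    Q (x * y) ∈ eigenSet τ (μ * ν) := by
  have h1 := hn p _ _ ‖x * y‖ (fun n => (hτ.pow (n : ℕ)).norm_apply_le (x * y)) (hQ (x * y))
  refine h1.unique fun ξ η => ?_
  have hc : ‖(starRingEnd ℂ) (μ * ν)‖ = 1 := by simp [hμ, hν]
  have hc0 : μ * ν ≠ 0 := norm_ne_zero_iff.1 (by rw [norm_mul, hμ, hν]; norm_num)
  -- The shift by one compares τ^{n+1}(xy) with its rescaling; the extra factor left over is the
  -- eigenvalue μν.
  have h2 := ((tendsto_add_atTop_iff_nat 1).2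
    (tendsto_pow_mul_apply_projection hτ hp hQ hμ hν hx hy ξ)).comp hp.tendsto_coe
  have h3 := ((hp.tendsto_pow hc).mul_const (starRingEnd ℂ (μ * ν))).mul
    (h2.inner (tendsto_const_nhds (x := η)))
  rw [one_mul] at h3
  rw [smul_apply, inner_smul_left]
  refine h3.congr fun n => ?_
  rw [← map_pow, ← map_mul, ← pow_succ, Function.comp_apply, ← inner_smul_left, smul_smul,
    mul_inv_cancel₀ (pow_ne_zero _ hc0), one_smul, pow_succ', Module.End.mul_apply]

end Projection

/-! ### The Choi–Effros product -/

namespace IsUnitalCP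

variable {Q : (K →L[ℂ] K) →ₗ[ℂ] (K →L[ℂ] K)}

/-- Q of the defect at z + t w is positive and has no term of order zero in t, because Q z = z and Q
w = 0. A form with vanishing constant term must have vanishing cross term. -/
theorem projection_star_mul_eq_zero (hQ : IsUnitalCP Q) (hidem : ∀ x, Q (Q x) = Q x)
    {z w : K →L[ℂ] K} (hz : Q z = z) (hw : Q w = 0) : Q (star z * w) = 0 := by
  refine ContinuousLinearMap.ext fun ξ => ?_
  suffices h : ∀ ξ, inner ℂ (Q (star z * w) ξ) ξ = 0 by
    have h2 := (inner_map_self_eq_zero (Q (star z * w) : K →ₗ[ℂ] K)).1 h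
    exact LinearMap.congr_fun h2 ξ
  intro ξ
  suffices h : ‖inner ℂ ξ (Q (star z * w) ξ)‖ ^ 2 ≤ 0 * (inner ℂ ξ (Q (star w * w) ξ)).re by
    rw [zero_mul] at h
    rw [← inner_conj_symm, norm_eq_zero.1 (pow_eq_zero_iff two_ne_zero |>.1
      (le_antisymm h (sq_nonneg _))), map_zero]
  refine sq_norm_le_mul_of_forall_nonneg fun t => ?_
  have h1 := hQ.re_inner_apply_nonneg (hQ.re_inner_multDefect_nonneg (z + t • w)) ξ
  have h2 : Q (multDefect Q (z + t • w) (z + t • w)) =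
      t • Q (star z * w) + (starRingEnd ℂ t) • star (Q (star z * w))
        + (t * starRingEnd ℂ t) • Q (star w * w) := by
    rw [← hQ.map_star]
    simp only [multDefect, map_sub, map_add, map_smul, hidem, hz, hw, smul_zero, add_zero,
      star_add, star_smul, add_mul, mul_add, smul_mul_assoc, mul_smul_comm, star_mul, star_star,
      starRingEnd_apply, mul_smul, smul_add]
    abel
  rw [h2] at h1
  simp only [add_apply, smul_apply, inner_add_right, inner_smul_right, inner_star_apply,
    Complex.add_re] at h1
  rw [← map_mul, Complex.conj_re, Complex.mul_conj, Complex.re_ofReal_mul,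
    Complex.normSq_eq_norm_sq] at h1
  linarith

/-- The Choi-Effros identity. -/
theorem projection_mul_right (hQ : IsUnitalCP Q) (hidem : ∀ x, Q (Q x) = Q x)
    {z : K →L[ℂ] K} (hz : Q z = z) (x : K →L[ℂ] K) : Q (z * Q x) = Q (z * x) := by
  have h := hQ.projection_star_mul_eq_zero hidem (z := star z) (w := Q x - x)
    (by rw [hQ.map_star, hz]) (by rw [map_sub, hidem, sub_self])
  rwa [star_star, mul_sub, map_sub, sub_eq_zero] at h

theorem projection_mul_left (hQ : IsUnitalCP Q) (hidem : ∀ x, Q (Q x) = Q x)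
    {z : K →L[ℂ] K} (hz : Q z = z) (x : K →L[ℂ] K) : Q (Q x * z) = Q (x * z) := by
  have h := hQ.projection_mul_right hidem (z := star z) (by rw [hQ.map_star, hz]) (star x)
  rw [hQ.map_star, ← star_mul, ← star_mul, hQ.map_star, hQ.map_star] at h
  exact star_injective h

/-- Kadison–Schwarz at a fixed point of Q: ‖x ξ‖² ≤ ⟨ξ, Q(x* x) ξ⟩. This is the nontrivial half of
the C*-identity for the new product. -/
theorem norm_mul_self_le_projection (hQ : IsUnitalCP Q) {x : K →L[ℂ] K} (hx : Q x = x) :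
    ‖x‖ * ‖x‖ ≤ ‖Q (star x * x)‖ := by
  rw [← sq]
  have h : ‖x‖ ≤ √‖Q (star x * x)‖ := by
    refine ContinuousLinearMap.opNorm_le_bound _ (Real.sqrt_nonneg _) fun ξ => ?_
    refine (pow_le_pow_iff_left₀ (norm_nonneg _) (by positivity) two_ne_zero).1 ?_
    rw [mul_pow, Real.sq_sqrt (norm_nonneg _)]
    have h1 := hQ.sq_norm_apply_le x ξ
    rw [hx] at h1
    calc _ ≤ _ := h1
      _ ≤ ‖inner ℂ ξ (Q (star x * x) ξ)‖ := Complex.re_le_norm _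
      _ ≤ ‖ξ‖ * ‖Q (star x * x) ξ‖ := norm_inner_le_norm _ _
      _ ≤ ‖ξ‖ * (‖Q (star x * x)‖ * ‖ξ‖) := by
        gcongr
        exact ContinuousLinearMap.le_opNorm _ _
      _ = _ := by ring
  exact (Real.le_sqrt (norm_nonneg _) (norm_nonneg _)).1 h

/-- The C*-algebra structure with product `Q (x y)` on a closed operator system in the range of
a unital completely positive projection `Q`. -/
@[reducible]
def choiEffrosCStarAlgebra (hQ : IsUnitalCP Q) (hidem : ∀ x, Q (Q x) = Q x)
    (P : Submodule ℂ (K →L[ℂ] K)) (hfix : ∀ x ∈ P, Q x = x) (hone : 1 ∈ P)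
    (hstar : ∀ x ∈ P, star x ∈ P) (hmul : ∀ x ∈ P, ∀ y ∈ P, Q (x * y) ∈ P)
    (hclosed : IsClosed (P : Set (K →L[ℂ] K))) : CStarAlgebra P :=
  letI ring : NormedRing P :=
    { (inferInstance : NormedAddCommGroup P) with
      mul := fun x y => ⟨Q (x * y), hmul _ x.2 _ y.2⟩
      one := ⟨1, hone⟩
      left_distrib := fun x y z => Subtype.ext <| by
        change Q (x * (y + z)) = Q (x * y) + Q (x * z)
        rw [mul_add, map_add]
      right_distrib := fun x y z => Subtype.ext <| by
        change Q ((x + y) * z) = Q (x * z) + Q (y * z)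
        rw [add_mul, map_add]
      zero_mul := fun x => Subtype.ext <| by
        change Q (0 * x) = 0
        rw [zero_mul, map_zero]
      mul_zero := fun x => Subtype.ext <| by
        change Q (x * 0) = 0
        rw [mul_zero, map_zero]
      mul_assoc := fun x y z => Subtype.ext <| by
        change Q (Q (x * y) * z) = Q (x * Q (y * z))
        rw [hQ.projection_mul_left hidem (hfix _ z.2), hQ.projection_mul_right hidem (hfix _ x.2),
          mul_assoc]
      one_mul := fun x => Subtype.ext <| by
        change Q (1 * x) = x
        rw [one_mul, hfix _ x.2]
      mul_one := fun x => Subtype.ext <| by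
        change Q (x * 1) = x
        rw [mul_one, hfix _ x.2]
      norm_mul_le := fun x y => (hQ.norm_apply_le _).trans (norm_mul_le (x : K →L[ℂ] K) y) }
  letI : StarRing P :=
    { star := fun x => ⟨star x, hstar _ x.2⟩
      star_involutive := fun x => Subtype.ext (star_star (x : K →L[ℂ] K))
      star_mul := fun x y => Subtype.ext <| by
        change star (Q (x * y)) = Q (star (y : K →L[ℂ] K) * star (x : K →L[ℂ] K))
        rw [← hQ.map_star, star_mul]
      star_add := fun x y => Subtype.ext (star_add (x : K →L[ℂ] K) y) }
  letI : NormedAlgebra ℂ P :=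
    { Algebra.ofModule (R := ℂ) (A := P)
        (fun c x y => Subtype.ext <| by
          change Q ((c • (x : K →L[ℂ] K)) * y) = c • Q (x * y)
          rw [smul_mul_assoc, map_smul])
        (fun c x y => Subtype.ext <| by
          change Q (x * (c • (y : K →L[ℂ] K))) = c • Q (x * y)
          rw [mul_smul_comm, map_smul]) with
      norm_smul_le := fun c x => norm_smul_le c (x : K →L[ℂ] K) }
  { ring, (inferInstance : StarRing P), (inferInstance : NormedAlgebra ℂ P) with
    complete := fun {f} hf => (hclosed.completeSpace_coe).complete hf
    norm_mul_self_le := fun x => hQ.norm_mul_self_le_projection (hfix _ x.2)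
    star_smul := fun c x => Subtype.ext (star_smul c (x : K →L[ℂ] K)) }

theorem exists_choiEffros_cstarAlgebra (hQ : IsUnitalCP Q) (hidem : ∀ x, Q (Q x) = Q x)
    (P : Submodule ℂ (K →L[ℂ] K)) (hfix : ∀ x ∈ P, Q x = x) (hone : 1 ∈ P)
    (hstar : ∀ x ∈ P, star x ∈ P) (hmul : ∀ x ∈ P, ∀ y ∈ P, Q (x * y) ∈ P)
    (hclosed : IsClosed (P : Set (K →L[ℂ] K))) :
    ∃ (A : Type u) (_ : CStarAlgebra A) (ι : A →ₗᵢ[ℂ] (K →L[ℂ] K)),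
      Set.range ι = (P : Set (K →L[ℂ] K)) ∧ ι 1 = 1 ∧ (∀ a, ι (star a) = star (ι a)) ∧
      ∀ a b, ι (a * b) = Q (ι a * ι b) := by
  let _ := hQ.choiEffrosCStarAlgebra hidem P hfix hone hstar hmul hclosed
  exact ⟨P, inferInstance,
    { toFun := Subtype.val
      map_add' := fun _ _ => rfl
      map_smul' := fun _ _ => rfl
      norm_map' := fun _ => rfl }, Subtype.range_val, rfl, fun _ => rfl, fun _ _ => rfl⟩

end IsUnitalCP

/-! ### Mean ergodic theory of a *-endomorphism -/

section ErgodicMean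

variable {A : Type u} [CStarAlgebra A]

/-- The averages `n⁻¹ ∑_{k < n} α ^ k` of the powers of a *-endomorphism. -/
def ergodicMean (α : A →⋆ₐ[ℂ] A) (n : ℕ) : A →ₗ[ℂ] A :=
  (n : ℝ)⁻¹ • ∑ k ∈ Finset.range n, ((α ^ k : A →⋆ₐ[ℂ] A) : A →ₗ[ℂ] A)

variable (α : A →⋆ₐ[ℂ] A)

theorem StarAlgHom.pow_apply_eq_iterate (n : ℕ) (a : A) : (α ^ n) a = α^[n] a := by
  induction n generalizing a with
  | zero => rfl
  | succ n ih => rw [pow_succ, Function.iterate_succ_apply, ← ih]; rfl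

theorem ergodicMean_apply (n : ℕ) (a : A) :
    ergodicMean α n a = (n : ℝ)⁻¹ • ∑ k ∈ Finset.range n, (α ^ k) a := by
  simp [ergodicMean]

theorem ergodicMean_eq_birkhoffAverage (n : ℕ) (a : A) :
    ergodicMean α n a = birkhoffAverage ℝ α _root_.id n a := by
  simp [ergodicMean_apply, birkhoffAverage, birkhoffSum, StarAlgHom.pow_apply_eq_iterate]

theorem norm_ergodicMean_le (n : ℕ) (a : A) : ‖ergodicMean α n a‖ ≤ ‖a‖ := by
  rw [ergodicMean_apply, norm_smul, norm_inv, Real.norm_natCast]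
  have h : ‖∑ k ∈ Finset.range n, (α ^ k) a‖ ≤ n * ‖a‖ := by
    refine (norm_sum_le_of_le (f := fun k => (α ^ k) a) (n := fun _ => ‖a‖) _ fun k _ =>
      NonUnitalStarAlgHom.norm_apply_le (α ^ k) a).trans_eq ?_
    simp
  rcases n.eq_zero_or_pos with rfl | hn
  · simp
  · rwa [inv_mul_le_iff₀ (by positivity)]

/-- The sum telescopes to two terms of norm at most ‖a‖, which are divided by n. -/
theorem tendsto_ergodicMean_apply_sub (a : A) :
    Tendsto (fun n => ergodicMean α n (α a - a)) atTop (𝓝 0) := by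
  simp only [map_sub, ergodicMean_eq_birkhoffAverage]
  refine tendsto_birkhoffAverage_apply_sub_birkhoffAverage ℝ ?_
  refine isBounded_iff_forall_norm_le.2 ⟨‖a‖, ?_⟩
  rintro _ ⟨n, rfl⟩
  simp only [id_eq, ← StarAlgHom.pow_apply_eq_iterate]
  exact NonUnitalStarAlgHom.norm_apply_le (α ^ n) a

theorem ergodicMean_apply_of_fixed {a : A} (ha : α a = a) {n : ℕ} (hn : n ≠ 0) :
    ergodicMean α n a = a := by
  rw [ergodicMean_eq_birkhoffAverage]
  exact Function.IsFixedPt.birkhoffAverage_eq ℝ (f := α) ha _ (by exact_mod_cast hn)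

theorem ergodicMean_mul_mul {s t : A} (hs : α s = s) (ht : α t = t) (n : ℕ) (a : A) :
    ergodicMean α n (s * a * t) = s * ergodicMean α n a * t := by
  have h : ∀ {s}, α s = s → ∀ k, (α ^ k) s = s := fun hs k => by
    rw [StarAlgHom.pow_apply_eq_iterate]
    exact Function.IsFixedPt.iterate (f := α) hs k
  simp only [ergodicMean_apply, map_mul, h hs, h ht, mul_smul_comm, smul_mul_assoc,
    Finset.mul_sum, Finset.sum_mul]

/-- The elements at which the ergodic means converge in norm. -/
def ergodicConvergence : Submodule ℂ A where
  carrier := {a | ∃ b, Tendsto (fun n => ergodicMean α n a) atTop (𝓝 b)}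
  add_mem' := by
    rintro a b ⟨a', ha⟩ ⟨b', hb⟩
    exact ⟨a' + b', by simpa only [map_add] using ha.add hb⟩
  zero_mem' := ⟨0, by simp only [map_zero]; exact tendsto_const_nhds⟩
  smul_mem' := by
    rintro c a ⟨a', ha⟩
    exact ⟨c • a', by simpa only [map_smul] using ha.const_smul c⟩

/-- The means are uniformly contractive, so an ε/3 argument applies. -/
theorem isClosed_ergodicConvergence : IsClosed (ergodicConvergence α : Set A) := by
  refine isClosed_of_closure_subset fun a ha => cauchySeq_tendsto_of_complete ?_
  rw [Metric.cauchySeq_iff]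
  intro ε hε
  obtain ⟨b, ⟨b', hb⟩, hab⟩ := Metric.mem_closure_iff.1 ha (ε / 3) (by positivity)
  obtain ⟨N, hN⟩ := Metric.cauchySeq_iff.1 hb.cauchySeq (ε / 3) (by positivity)
  have h : ∀ n, dist (ergodicMean α n a) (ergodicMean α n b) < ε / 3 := fun n => by
    rw [dist_eq_norm, ← map_sub]
    exact (norm_ergodicMean_le α n _).trans_lt (by rwa [← dist_eq_norm])
  refine ⟨N, fun m hm n hn => ?_⟩
  have h1 := h m
  have h2 := h n
  have h3 := hN m hm n hn
  rw [dist_comm] at h2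
  have h4 := dist_triangle4 (ergodicMean α m a) (ergodicMean α m b) (ergodicMean α n b)
    (ergodicMean α n a)
  linarith

/-- For μ ≠ 1 the eigenvector is a coboundary α b - b with b = (μ - 1)⁻¹ a, so its means tend to 0.
-/
theorem mem_ergodicConvergence_of_eigenvector {μ : ℂ} {a : A} (ha : α a = μ • a) :
    a ∈ ergodicConvergence α := by
  by_cases hμ : μ = 1
  · refine ⟨a, tendsto_const_nhds.congr' ?_⟩
    filter_upwards [eventually_ne_atTop 0] with n hn
    rw [ergodicMean_apply_of_fixed α (by rw [ha, hμ, one_smul]) hn]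
  · refine ⟨0, ?_⟩
    have h := tendsto_ergodicMean_apply_sub α ((μ - 1)⁻¹ • a)
    rwa [map_smul, ha, smul_smul, ← sub_smul, ← mul_sub_one, inv_mul_cancel₀ (sub_ne_zero.2 hμ),
      one_smul] at h

theorem ergodicMean_map_cstarMatrix_nonneg [PartialOrder A] [StarOrderedRing A] (n : ℕ) {k : ℕ}
    {M : CStarMatrix (Fin k) (Fin k) A} (hM : 0 ≤ M) : 0 ≤ M.map (ergodicMean α n) := by
  have h : M.map (ergodicMean α n) = (n : ℝ)⁻¹ • ∑ j ∈ Finset.range n, M.map (α ^ j) := by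
    ext i j
    have h2 : (∑ l ∈ Finset.range n, M.map (α ^ l)) i j
        = ∑ l ∈ Finset.range n, (M.map (α ^ l)) i j := Matrix.sum_apply i j _ _
    rw [CStarMatrix.smul_apply, h2, CStarMatrix.map_apply, ergodicMean_apply]
    rfl
  rw [h]
  exact smul_nonneg (by positivity) (Finset.sum_nonneg fun j _ =>
    CompletelyPositiveMapClass.map_cstarMatrix_nonneg' (α ^ j) k M hM)

/-- If the ergodic means of a *-endomorphism converge pointwise, the limit is a conditional
expectation onto its fixed points. -/
theorem exists_conditionalExpectation_equalizer [PartialOrder A] [StarOrderedRing A]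
    (h : ergodicConvergence α = ⊤) :
    ∃ E : A →CP A, IsConditionalExpectationOnto (StarAlgHom.equalizer α (StarAlgHom.id ℂ A)) E := by
  have hall : ∀ a, ∃ b, Tendsto (fun n => ergodicMean α n a) atTop (𝓝 b) := fun a => by
    have ha : a ∈ ergodicConvergence α := h ▸ Submodule.mem_top
    exact ha
  choose E hE using hall
  have hfix : ∀ a, α a = a → E a = a := fun a ha =>
    tendsto_nhds_unique_of_eventuallyEq (hE a) tendsto_const_nhds (by
      filter_upwards [eventually_ne_atTop 0] with n hn
      exact ergodicMean_apply_of_fixed α ha hn)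
  have hrange : ∀ a, α (E a) = E a := fun a => by
    have h1 : Tendsto (fun n => α (ergodicMean α n a)) atTop (𝓝 (α (E a))) :=
      ((map_continuous α).tendsto _).comp (hE a)
    -- The means of α a and of a have the same limit, and α commutes with the means.
    have h2 := (tendsto_ergodicMean_apply_sub α a).add (hE a)
    rw [zero_add] at h2
    refine tendsto_nhds_unique h1 (h2.congr fun n => ?_)
    rw [map_sub, sub_add_cancel, ergodicMean_eq_birkhoffAverage, ergodicMean_eq_birkhoffAverage,
      map_birkhoffAverage ℝ ℝ α]
    simp only [birkhoffAverage, birkhoffSum, ← Function.iterate_succ_apply,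
      Function.iterate_succ_apply', Function.comp_apply, id_eq]
  let L : A →ₗ[ℂ] A :=
    { toFun := E
      map_add' := fun a b => tendsto_nhds_unique (hE (a + b)) (by
        simpa only [map_add] using (hE a).add (hE b))
      map_smul' := fun c a => tendsto_nhds_unique (hE (c • a)) (by
        simpa only [map_smul, RingHom.id_apply] using (hE a).const_smul c) }
  have hpos : ∀ (k : ℕ) (M : CStarMatrix (Fin k) (Fin k) A), 0 ≤ M → 0 ≤ M.map L := by
    intro k M hM
    -- Matrices carry the entrywise topology, and the positive cone is closed.
    have hlim : Tendsto (fun n => M.map (ergodicMean α n)) atTop (𝓝 (M.map L)) :=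
      tendsto_pi_nhds.2 fun i => tendsto_pi_nhds.2 fun j => hE (M i j)
    exact ge_of_tendsto' hlim fun n => ergodicMean_map_cstarMatrix_nonneg α n hM
  refine ⟨⟨L, hpos⟩, ?_, fun s hs => hfix s hs, fun a => hfix _ (hrange a), fun a => ?_,
    fun s hs t ht a => ?_⟩
  · ext a
    exact ⟨by rintro ⟨b, rfl⟩; exact hrange b, fun ha => ⟨a, hfix a ha⟩⟩
  · exact le_of_tendsto' (hE a).norm fun n => norm_ergodicMean_le α n a
  · refine tendsto_nhds_unique (hE (s * a * t)) ?_
    simp only [ergodicMean_mul_mul α (show α s = s from hs) (show α t = t from ht)]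
    exact ((hE a).const_mul s).mul_const t

end ErgodicMean

/-! ### The peripheral boundary as a C*-algebra with conditional expectation -/

section Peripheral

variable {τ : (K →L[ℂ] K) →ₗ[ℂ] (K →L[ℂ] K)}

theorem IsUnitalCP.continuous (hτ : IsUnitalCP τ) : Continuous τ :=
  AddMonoidHomClass.continuous_of_bound τ 1 fun x => by
    rw [one_mul]; exact hτ.norm_apply_le x

theorem mem_peripheralSpace_of_mem_eigenSet {μ : ℂ} (hμ : ‖μ‖ = 1) {x : K →L[ℂ] K}
    (hx : x ∈ eigenSet τ μ) : x ∈ peripheralSpace τ :=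
  Submodule.le_topologicalClosure _ (Submodule.subset_span ⟨μ, hμ, hx⟩)

theorem isClosed_peripheralSpace : IsClosed (peripheralSpace τ : Set (K →L[ℂ] K)) :=
  Submodule.isClosed_topologicalClosure _

theorem peripheralSpace_le {M : Submodule ℂ (K →L[ℂ] K)}
    (hM : IsClosed (M : Set (K →L[ℂ] K)))
    (h : ∀ μ : ℂ, ‖μ‖ = 1 → ∀ x ∈ eigenSet τ μ, x ∈ M) : peripheralSpace τ ≤ M :=
  Submodule.topologicalClosure_minimal _
    (Submodule.span_le.2 fun x ⟨μ, hμ, hx⟩ => h μ hμ x hx) hM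

theorem star_mem_peripheralSpace (hτ : IsUnitalCP τ) {x : K →L[ℂ] K}
    (hx : x ∈ peripheralSpace τ) : star x ∈ peripheralSpace τ := by
  refine map_mem_closure (t := (Submodule.span ℂ
    {x | ∃ μ : ℂ, ‖μ‖ = 1 ∧ x ∈ eigenSet τ μ} : Set (K →L[ℂ] K))) continuous_star hx fun y hy => ?_
  induction hy using Submodule.span_induction with
  | mem y hy =>
    obtain ⟨μ, hμ, hy⟩ := hy
    exact Submodule.subset_span ⟨star μ, by rwa [norm_star], hτ.star_mem_eigenSet hy⟩
  | zero => rw [star_zero]; exact Submodule.zero_mem _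
  | add y z _ _ hy hz => rw [star_add]; exact Submodule.add_mem _ hy hz
  | smul c y _ hy => rw [star_smul]; exact Submodule.smul_mem _ _ hy

/-- Linearity and continuity reduce the claim to eigenvectors, one factor at a time. -/
theorem map_mul_mem_peripheralSpace {Q : (K →L[ℂ] K) →ₗ[ℂ] (K →L[ℂ] K)} (hQ : Continuous Q)
    (h : ∀ μ ν : ℂ, ‖μ‖ = 1 → ‖ν‖ = 1 → ∀ x ∈ eigenSet τ μ, ∀ y ∈ eigenSet τ ν,
      Q (x * y) ∈ peripheralSpace τ) {x y : K →L[ℂ] K} (hx : x ∈ peripheralSpace τ)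
    (hy : y ∈ peripheralSpace τ) : Q (x * y) ∈ peripheralSpace τ := by
  have h1 : ∀ ν : ℂ, ‖ν‖ = 1 → ∀ z ∈ eigenSet τ ν, Q (x * z) ∈ peripheralSpace τ :=
    fun ν hν z hz => peripheralSpace_le
      (M := (peripheralSpace τ).comap (Q ∘ₗ LinearMap.mulRight ℂ z))
      (isClosed_peripheralSpace.preimage (hQ.comp (continuous_mul_const z)))
      (fun μ hμ w hw => h μ ν hμ hν w hw z hz) hx
  exact peripheralSpace_le (M := (peripheralSpace τ).comap (Q ∘ₗ LinearMap.mulLeft ℂ x))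
    (isClosed_peripheralSpace.preimage (hQ.comp (continuous_const_mul x)))
    (fun ν hν z hz => h1 ν hν z hz) hy

theorem IsUnitalCP.one_mem_eigenSet (hτ : IsUnitalCP τ) : 1 ∈ eigenSet τ 1 := by
  change τ 1 = (1 : ℂ) • 1
  rw [hτ.map_one, one_smul]

/-- The peripheral Poisson boundary of a normal unital completely positive map is a C*-algebra. -/
theorem IsUnitalCP.exists_isPeripheralPoissonBoundary (hτ : IsUnitalCP τ) (hn : IsNormalMap τ) :
    ∃ (A : Type u) (_ : CStarAlgebra A) (ι : A →ₗᵢ[ℂ] (K →L[ℂ] K)),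
      IsPeripheralPoissonBoundary τ ι ∧ ∀ μ ν : ℂ, ‖μ‖ = 1 → ‖ν‖ = 1 → ∀ a b : A,
        ι a ∈ eigenSet τ μ → ι b ∈ eigenSet τ ν → ι (a * b) ∈ eigenSet τ (μ * ν) := by
  obtain ⟨p, hp1, hp2⟩ := exists_idempotent_ultrafilter_pnat
  have hp : IsFreeIdempotent p := ⟨hp1, hp2⟩
  obtain ⟨Q, hQ, hidem, hlim⟩ := hτ.exists_projection hn hp
  have heig : ∀ μ ν : ℂ, ‖μ‖ = 1 → ‖ν‖ = 1 → ∀ x ∈ eigenSet τ μ, ∀ y ∈ eigenSet τ ν,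
      Q (x * y) ∈ eigenSet τ (μ * ν) := fun μ ν hμ hν x hx y hy =>
    projection_mul_mem_eigenSet hτ hn hp hlim hμ hν hx hy
  have hfix : ∀ x ∈ peripheralSpace τ, Q x = x := peripheralSpace_le
    (M := LinearMap.eqLocus Q LinearMap.id) (isClosed_eq hQ.continuous continuous_id)
    (fun μ hμ x hx => projection_apply_of_mem_eigenSet hp hlim hμ hx)
  obtain ⟨A, hA, ι, hι1, hι2, hι3, hι4⟩ := hQ.exists_choiEffros_cstarAlgebra hidem
    (peripheralSpace τ) hfix (mem_peripheralSpace_of_mem_eigenSet norm_one hτ.one_mem_eigenSet)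
    (fun x hx => star_mem_peripheralSpace hτ hx)
    (fun x hx y hy => map_mul_mem_peripheralSpace hQ.continuous
      (fun μ ν hμ hν x hx y hy => mem_peripheralSpace_of_mem_eigenSet
        (by rw [norm_mul, hμ, hν, one_mul]) (heig μ ν hμ hν x hx y hy)) hx hy)
    isClosed_peripheralSpace
  refine ⟨A, hA, ι, ⟨hι1, hι2, hι3, fun μ ν hμ hν a b ha hb ξ => ?_⟩,
    fun μ ν hμ hν a b ha hb => ?_⟩
  · rw [hι4]
    simpa only [Module.End.pow_apply] using
      tendsto_pow_mul_apply_projection hτ hp hlim hμ hν ha hb ξ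
  · rw [hι4]
    exact heig μ ν hμ hν _ ha _ hb

variable {A : Type u} [CStarAlgebra A] {ι : A →ₗᵢ[ℂ] (K →L[ℂ] K)}

/-- The density principle transported to A: ι is isometric, so it maps closed subspaces to closed
subspaces. -/
theorem IsPeripheralPoissonBoundary.eq_top_of_isClosed (h : IsPeripheralPoissonBoundary τ ι)
    {M : Submodule ℂ A} (hM : IsClosed (M : Set A))
    (hmem : ∀ μ : ℂ, ‖μ‖ = 1 → ∀ a, ι a ∈ eigenSet τ μ → a ∈ M) : M = ⊤ := by
  refine eq_top_iff.2 fun a _ => ?_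
  have h1 : peripheralSpace τ ≤ M.map ι.toLinearMap := by
    refine peripheralSpace_le (ι.isometry.isClosedEmbedding.isClosedMap _ hM) fun μ hμ x hx => ?_
    have h2 : x ∈ Set.range ι := by
      rw [h.range_eq]
      exact mem_peripheralSpace_of_mem_eigenSet hμ hx
    obtain ⟨b, rfl⟩ := h2
    exact ⟨b, hmem μ hμ b hx, rfl⟩
  have h2 : ι a ∈ (peripheralSpace τ : Set (K →L[ℂ] K)) := h.range_eq ▸ Set.mem_range_self a
  obtain ⟨b, hb, hab⟩ := h1 h2
  rwa [← ι.injective hab]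

/-- `τ` acts on its peripheral Poisson boundary by a *-endomorphism. -/
theorem IsPeripheralPoissonBoundary.exists_starAlgHom (h : IsPeripheralPoissonBoundary τ ι)
    (hτ : IsUnitalCP τ) (hmul : ∀ μ ν : ℂ, ‖μ‖ = 1 → ‖ν‖ = 1 → ∀ a b : A,
      ι a ∈ eigenSet τ μ → ι b ∈ eigenSet τ ν → ι (a * b) ∈ eigenSet τ (μ * ν)) :
    ∃ α : A →⋆ₐ[ℂ] A, ∀ a, ι (α a) = τ (ι a) := by
  have hex : ∀ a, ∃ b, ι b = τ (ι a) := fun a => by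
    have h1 : peripheralSpace τ ≤ (peripheralSpace τ).comap τ :=
      peripheralSpace_le (isClosed_peripheralSpace.preimage hτ.continuous) fun μ hμ x hx => by
        have hx' : τ x = μ • x := hx
        rw [Submodule.mem_comap, hx']
        exact Submodule.smul_mem _ _ (mem_peripheralSpace_of_mem_eigenSet hμ hx)
    have h2 : ι a ∈ (peripheralSpace τ : Set (K →L[ℂ] K)) := h.range_eq ▸ Set.mem_range_self a
    have h3 : τ (ι a) ∈ (peripheralSpace τ : Set (K →L[ℂ] K)) := h1 h2
    rwa [← h.range_eq] at h3
  choose f hf using hex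
  let L : A →ₗ[ℂ] A :=
    { toFun := f
      map_add' := fun a b => ι.injective (by simp only [map_add, hf])
      map_smul' := fun c a => ι.injective (by simp only [map_smul, hf, RingHom.id_apply]) }
  have hL : Continuous L := AddMonoidHomClass.continuous_of_bound L 1 fun a => by
    change ‖f a‖ ≤ _
    rw [one_mul, ← ι.norm_map, hf, ← ι.norm_map a]
    exact hτ.norm_apply_le _
  have hLeig : ∀ {μ a}, ι a ∈ eigenSet τ μ → L a = μ • a := fun {μ a} ha =>
    ι.injective (by
      have ha' : τ (ι a) = μ • ι a := ha
      change ι (f a) = _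
      rw [hf, ha', map_smul])
  -- On eigenvectors both sides are μν • (a * b), because the product respects the grading by
  -- eigenvalues; density then extends this in each variable.
  have hLmul : ∀ a b, L (a * b) = L a * L b := by
    have h1 : ∀ ν : ℂ, ‖ν‖ = 1 → ∀ b, ι b ∈ eigenSet τ ν → ∀ a, L (a * b) = L a * L b := by
      intro ν hν b hb a
      have h2 := h.eq_top_of_isClosed (M := LinearMap.eqLocus (L ∘ₗ LinearMap.mulRight ℂ b)
        (LinearMap.mulRight ℂ (L b) ∘ₗ L))
        (isClosed_eq (hL.comp (continuous_mul_const b)) ((continuous_mul_const (L b)).comp hL))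
        (fun μ hμ a ha => by
          change L (a * b) = L a * L b
          rw [hLeig ha, hLeig hb, hLeig (hmul μ ν hμ hν a b ha hb), smul_mul_smul_comm])
      have h3 : a ∈ (⊤ : Submodule ℂ A) := Submodule.mem_top
      rw [← h2] at h3
      exact h3
    intro a b
    have h2 := h.eq_top_of_isClosed (M := LinearMap.eqLocus (L ∘ₗ LinearMap.mulLeft ℂ a)
      (LinearMap.mulLeft ℂ (L a) ∘ₗ L))
      (isClosed_eq (hL.comp (continuous_const_mul a)) ((continuous_const_mul (L a)).comp hL))
      (fun ν hν b hb => h1 ν hν b hb a)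
    have h3 : b ∈ (⊤ : Submodule ℂ A) := Submodule.mem_top
    rw [← h2] at h3
    exact h3
  have hLone : L 1 = 1 := ι.injective (by
    change ι (f 1) = _
    rw [hf, h.map_one, hτ.map_one])
  exact ⟨{ AlgHom.ofLinearMap L hLone hLmul with
    map_star' := fun a => ι.injective (by
      change ι (f (star a)) = ι (star (f a))
      rw [hf, h.map_star, h.map_star, hf, hτ.map_star]) }, hf⟩

/-- The peripheral Poisson boundary of a normal unital completely positive map admits a
conditional expectation onto the Poisson boundary. -/
theorem IsUnitalCP.exists_peripheral_conditionalExpectation (hτ : IsUnitalCP τ)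
    (hn : IsNormalMap τ) :
    ∃ (A : Type u) (_ : CStarAlgebra A) (_ : PartialOrder A) (_ : StarOrderedRing A)
      (ι : A →ₗᵢ[ℂ] (K →L[ℂ] K)), IsPeripheralPoissonBoundary τ ι ∧
      ∃ F : StarSubalgebra ℂ A, IsClosed (F : Set A) ∧ ι '' (F : Set A) = poissonBoundary τ ∧
        ∃ E : A →CP A, IsConditionalExpectationOnto F E := by
  obtain ⟨A, hA, ι, hι, hmul⟩ := hτ.exists_isPeripheralPoissonBoundary hn
  obtain ⟨α, hα⟩ := hι.exists_starAlgHom hτ hmul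
  have hfix : ∀ a, a ∈ StarAlgHom.equalizer α (StarAlgHom.id ℂ A) ↔ τ (ι a) = ι a := fun a => by
    rw [← hα, ι.injective.eq_iff]
    rfl
  refine ⟨A, hA, CStarAlgebra.spectralOrder A, CStarAlgebra.spectralOrderedRing A, ι, hι,
    StarAlgHom.equalizer α (StarAlgHom.id ℂ A), isClosed_eq (map_continuous α) continuous_id, ?_,
    ?_⟩
  · ext x
    constructor
    · rintro ⟨a, ha, rfl⟩
      exact (hfix a).1 ha
    · intro (hx : τ x = x)
      have h1 : x ∈ (peripheralSpace τ : Set (K →L[ℂ] K)) :=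
        mem_peripheralSpace_of_mem_eigenSet norm_one
          (show τ x = (1 : ℂ) • x by rw [hx, one_smul])
      rw [← hι.range_eq] at h1
      obtain ⟨a, rfl⟩ := h1
      exact ⟨a, (hfix a).2 hx, rfl⟩
  · let _ := CStarAlgebra.spectralOrder A
    let _ := CStarAlgebra.spectralOrderedRing A
    refine exists_conditionalExpectation_equalizer α (hι.eq_top_of_isClosed
      (isClosed_ergodicConvergence α) fun μ _ a ha =>
        mem_ergodicConvergence_of_eigenvector α (μ := μ) (ι.injective ?_))
    have ha' : τ (ι a) = μ • ι a := ha
    rw [hα, ha', map_smul]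

end Peripheral

/-! ### The map `P_ω` on the full Fock space -/

section Fock

variable {H : Type u} [NormedAddCommGroup H] [InnerProductSpace ℂ H] {Θ : Type v}

theorem norm_leftCreation_apply (ξ : H) (f : FullFock H) : ‖leftCreation ξ f‖ = ‖ξ‖ * ‖f‖ := by
  have h := lp.norm_rpow_eq_tsum (p := 2) (by norm_num)
    (⟨creationFun ξ f, creationFun_memℓp ξ f⟩ : FullFock H)
  have h2 := (creationFun_hasSum ξ f).tsum_eq
  rw [← Real.rpow_left_inj (norm_nonneg _) (by positivity) (two_ne_zero)]
  refine Eq.trans ?_ h2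
  change ‖(⟨creationFun ξ f, creationFun_memℓp ξ f⟩ : FullFock H)‖ ^ (2 : ℝ) = _
  simpa using h

theorem inner_leftCreation_apply {ξ : H} (hξ : ‖ξ‖ = 1) (f g : FullFock H) :
    inner ℂ (leftCreation ξ f) (leftCreation ξ g) = inner ℂ f g :=
  LinearIsometry.inner_map_map
    { (leftCreation ξ : FullFock H →ₗ[ℂ] FullFock H) with
      norm_map' := fun f => by
        change ‖leftCreation ξ f‖ = ‖f‖
        rw [norm_leftCreation_apply, hξ, one_mul] } f g

variable {e : Θ → H} {ω : Θ → ℝ}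

/-- The weak form of the series: unitality, positivity and normality are all checked on these scalar
sums. -/
theorem hasSum_inner_fockMap (he : ∀ i, ‖e i‖ = 1) (hω : ∀ i, 0 ≤ ω i) (hs : Summable ω)
    (x : FullFock H →L[ℂ] FullFock H) (f g : FullFock H) :
    HasSum (fun i => (ω i : ℂ) * inner ℂ (leftCreation (e i) f) (x (leftCreation (e i) g)))
      (inner ℂ f (fockMap e ω x g)) := by
  have h := (hasSum_fockMap e he ω hω hs x).mapL
    ((innerSL ℂ f).comp (ContinuousLinearMap.apply ℂ (FullFock H) g))
  refine h.congr_fun fun i => ?_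
  change _ = inner ℂ f ((ω i : ℂ) • (ContinuousLinearMap.adjoint (leftCreation (e i))
    (x (leftCreation (e i) g))))
  rw [inner_smul_right, ContinuousLinearMap.adjoint_inner_right]

/-- `fockMap` as a linear map. -/
def fockLinearMap (he : ∀ i, ‖e i‖ = 1) (hω : ∀ i, 0 ≤ ω i) (hs : Summable ω) :
    (FullFock H →L[ℂ] FullFock H) →ₗ[ℂ] (FullFock H →L[ℂ] FullFock H) where
  toFun := fockMap e ω
  map_add' x y := by
    refine (hasSum_fockMap e he ω hω hs (x + y)).unique ?_
    simpa only [mul_add, add_mul, smul_add] using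
      (hasSum_fockMap e he ω hω hs x).add (hasSum_fockMap e he ω hω hs y)
  map_smul' c x := by
    refine (hasSum_fockMap e he ω hω hs (c • x)).unique ?_
    simpa only [mul_smul_comm, smul_mul_assoc, smul_comm c, RingHom.id_apply] using
      (hasSum_fockMap e he ω hω hs x).const_smul c

theorem fockLinearMap_isUnitalCP (he : ∀ i, ‖e i‖ = 1) (hω : ∀ i, 0 ≤ ω i) (hs : HasSum ω 1) :
    IsUnitalCP (fockLinearMap he hω hs.summable) where
  map_one := by
    refine ContinuousLinearMap.ext fun g => ext_inner_left ℂ fun f => ?_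
    refine (hasSum_inner_fockMap he hω hs.summable 1 f g).unique ?_
    simpa [inner_leftCreation_apply (he _)] using
      (Complex.hasSum_ofReal.2 hs).mul_right (inner ℂ f g)
  map_star x := by
    refine ContinuousLinearMap.ext fun g => ext_inner_left ℂ fun f => ?_
    refine (hasSum_inner_fockMap he hω hs.summable (star x) f g).unique ?_
    rw [inner_star_apply]
    refine (Complex.hasSum_conj'.1 ?_ : _)
    convert hasSum_inner_fockMap he hω hs.summable x g f using 1
    · funext i
      rw [inner_star_apply]
      simp
    · exact Complex.conj_conj _
  map_posMatrix a ha ξ := by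
    have h : HasSum (fun k => ω k * (∑ i, ∑ j, inner ℂ (leftCreation (e k) (ξ i))
        (a i j (leftCreation (e k) (ξ j)))).re)
        (∑ i, ∑ j, inner ℂ (ξ i) (fockMap e ω (a i j) (ξ j))).re := by
      have h2 := Complex.hasSum_re (hasSum_sum fun i (_ : i ∈ Finset.univ) =>
        hasSum_sum fun j (_ : j ∈ Finset.univ) =>
          hasSum_inner_fockMap he hω hs.summable (a i j) (ξ i) (ξ j))
      simpa only [← Finset.mul_sum, Complex.re_ofReal_mul] using h2
    exact h.nonneg fun k => mul_nonneg (hω k) (ha _)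

/-- Each summand is weakly continuous; on bounded sets the summable weights dominate the series, so
limit and sum interchange even for infinite Θ. -/
theorem fockLinearMap_isNormalMap (he : ∀ i, ‖e i‖ = 1) (hω : ∀ i, 0 ≤ ω i)
    (hs : Summable ω) : IsNormalMap (fockLinearMap he hω hs) := by
  intro l a b C hC h f g
  change Tendsto (fun n => inner ℂ (fockMap e ω (a n) f) g) l (𝓝 (inner ℂ (fockMap e ω b f) g))
  suffices h2 : Tendsto (fun n => inner ℂ g (fockMap e ω (a n) f)) l
      (𝓝 (inner ℂ g (fockMap e ω b f))) by
    have h3 := (Complex.continuous_conj.tendsto _).comp h2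
    simpa only [Function.comp_def, inner_conj_symm] using h3
  simp only [← (hasSum_inner_fockMap he hω hs _ _ _).tsum_eq]
  refine tendsto_tsum_of_dominated_convergence (bound := fun i => ω i * (‖g‖ * (C * ‖f‖)))
    (hs.mul_right _) (fun i => (h.tendsto_inner _ _).const_mul _)
    (Eventually.of_forall fun n i => ?_)
  rw [norm_mul, Complex.norm_real, Real.norm_of_nonneg (hω i)]
  refine mul_le_mul_of_nonneg_left ((norm_inner_le_norm _ _).trans ?_) (hω i)
  have h1 := (a n).le_of_opNorm_le (hC n) (leftCreation (e i) f)
  rw [norm_leftCreation_apply, he, one_mul] at h1 ⊢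
  gcongr

end Fock

end PeripheralBoundary

theorem proposition3 {H : Type u} [NormedAddCommGroup H] [InnerProductSpace ℂ H] [CompleteSpace H]
    {Θ : Type v} [Countable Θ] [Nontrivial Θ] (e : HilbertBasis Θ ℂ H)
    (ω : Θ → ℝ) (hω_pos : ∀ i, 0 < ω i) (hω_sum : HasSum ω 1) :
    ∃ (A : Type u) (_ : CStarAlgebra A) (_ : PartialOrder A) (_ : StarOrderedRing A)
      (ι : A →ₗᵢ[ℂ] (FullFock H →L[ℂ] FullFock H)),
      IsPeripheralPoissonBoundary (fockMap (fun i => e i) ω) ι ∧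
      ∃ F : StarSubalgebra ℂ A, IsClosed (F : Set A) ∧
        ι '' (F : Set A) = poissonBoundary (fockMap (fun i => e i) ω) ∧
        ∃ E : A →CP A, IsConditionalExpectationOnto F E := by
  have he : ∀ i, ‖e i‖ = 1 := fun i => e.orthonormal.1 i
  have hω : ∀ i, 0 ≤ ω i := fun i => (hω_pos i).le
  exact (fockLinearMap_isUnitalCP he hω hω_sum).exists_peripheral_conditionalExpectation
    (fockLinearMap_isNormalMap he hω hω_sum.summable)
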